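/- Let $0<q<1$ and $\alpha>-1$. Write $(a;q)_n=\prod_{k=0}^{n-1}(1-aq^k)$, $(a;q)_\infty=\prod_{k\ge 0}(1-aq^k)$, $[n]_q=\frac{1-q^n}{1-q}$, $[n]_q!=\prod_{k=1}^n[k]_q$, and $E_q(z)=\sum_{n\ge 0}\frac{q^{n(n-1)/2}}{(q;q)_n}(z(1-q))^n$. Let $$J^{(2)}_\alpha(z;q)=\frac{(q^{\alpha+1};q)_\infty}{(q;q)_\infty}\sum_{n\ge 0}(-1)^n\frac{q^{n(\alpha+n)}(z/2)^{2n+\alpha}}{(q;q)_n(q^{\alpha+1};q)_n}$$ be the second Jackson $q$-Bessel function, let $\mathcal J^{(2)}_\alpha(z;q)=\frac{(q;q)_\infty}{(q^{\alpha+1};q)_\infty}(z/2)^{-\alpha}J^{(2)}_\alpha(z;q)$ (an entire function of $z$), let $g^{(2)}_\alpha(t;q)=\mathcal J^{(2)}_\alpha(t(1-q);q^2)$, and let $j^{(2)}_{1,\alpha}$ be the smallest positive zero of $J^{(2)}_\alpha(\cdot;q^2)$. The generalized $q$-Bernoulli polynomials $B^{(2)}_{n,\alpha}(z;q)$ are defined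 by $$\frac{E_q(zt)\,E_q(-t/2)}{g^{(2)}_\alpha(it;q)}=\sum_{n\ge 0}B^{(2)}_{n,\alpha}(z;q)\frac{t^n}{[n]_q!}$$ near $t=0$. Let $f(z)=\sum_{n\ge0}f_nz^n$ $(z\in\mathbb C)$ satisfy $$\limsup_{n\to\infty}\left|\frac{f_n}{\Psi_n}\right|^{1/n}=\tau,\qquad \Psi_n=\frac{q^{n(n-1)/2}}{[n]_q!},\qquad 0\le\tau<\min\left\{\frac{2}{1-q},\frac{j^{(2)}_{1,\alpha}}{1-q}\right\}.$$ Then for every $n\ge 0$ the series $$L_n(f)=(1-q)^{-n}\sum_{k=n}^{\infty}f_k\,\frac{q^{-k(k-1)/2}(q;q)_k\,(q^{2\alpha+1};q^2)_{k-n}\,(1/2)^{k-n}}{(q;q)_{k-n}\,(q^{2\alpha+1};q)_{k-n}}$$ converges absolutely, and for every $z\in\mathbb C$ $$f(z)=\sum_{n=0}^{\infty}L_n(f)\,\frac{B^{(2)}_{n,\alpha}(z;q)}{[n]_q!},$$ where the series converges absolutely. For $\alpha=-\tfrac12$ the quotient $(q^{2\alpha+1};q^2)_m/(q^{2\alpha+1};q)_m$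 is read as its limit as $\alpha\to-\tfrac12$, namely $1$ for $m=0$ and $(-q;q)_{m-1}$ for $m\ge1$. -/

import Mathlib

open Filter Topology

noncomputable section

namespace QBernoulli

/-- The finite `q`-shifted factorial `(a;q)_n = ∏_{k<n} (1 - a q^k)`. -/
def qPoch (a q : ℝ) (n : ℕ) : ℝ := ∏ k ∈ Finset.range n, (1 - a * q ^ k)

/-- The infinite `q`-shifted factorial `(a;q)_∞ = ∏_{k≥0} (1 - a q^k)` (for `0 < q < 1`). -/
def qPochInf (a q : ℝ) : ℝ := ∏' k : ℕ, (1 - a * q ^ k)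

/-- The `q`-natural number `[n]_q = (1 - q^n) / (1 - q)`. -/
def qNat (q : ℝ) (n : ℕ) : ℝ := (1 - q ^ n) / (1 - q)

/-- The `q`-factorial `[n]_q! = [1]_q [2]_q ⋯ [n]_q`. -/
def qFact (q : ℝ) (n : ℕ) : ℝ := ∏ k ∈ Finset.range n, qNat q (k + 1)

/-- Jackson's `q`-exponential function
`E_q(z) = ∑ q^{n(n-1)/2} (z(1-q))^n / (q;q)_n`, an entire function of `z`. -/
def bigEq (q : ℝ) (z : ℂ) : ℂ :=
  ∑' n : ℕ, ((q ^ (n * (n - 1) / 2) / qPoch q q n : ℝ) : ℂ) * (z * (1 - (q : ℂ))) ^ n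

/-- The second Jackson `q`-Bessel function `J_α^{(2)}(z;q)` (principal branch of the power). -/
def besselJ2 (α q : ℝ) (z : ℂ) : ℂ :=
  ((qPochInf (q ^ (α + 1)) q / qPochInf q q : ℝ) : ℂ) *
    ∑' n : ℕ, (-1 : ℂ) ^ n *
      ((q ^ ((n : ℝ) * (α + n)) / (qPoch q q n * qPoch (q ^ (α + 1)) q n) : ℝ) : ℂ) *
      (z / 2) ^ (2 * (n : ℂ) + (α : ℂ))

/-- The modified second Jackson `q`-Bessel function
`𝒥_α^{(2)}(z;q) = (q;q)_∞ / (q^{α+1};q)_∞ (z/2)^{-α} J_α^{(2)}(z;q)`, given by its power series,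
so that the removable singularity at `z = 0` is removed; it is an entire function of `z`.
The lemma `besselJ2_eq` below is the stated relation with `J_α^{(2)}`. -/
def modBesselJ2 (α q : ℝ) (z : ℂ) : ℂ :=
  ∑' n : ℕ, (-1 : ℂ) ^ n *
    ((q ^ ((n : ℝ) * (α + n)) / (qPoch q q n * qPoch (q ^ (α + 1)) q n) : ℝ) : ℂ) *
    (z / 2) ^ (2 * n)

theorem besselJ2_eq (α q : ℝ) {z : ℂ} (hz : z ≠ 0) :
    besselJ2 α q z =
      ((qPochInf (q ^ (α + 1)) q / qPochInf q q : ℝ) : ℂ) * (z / 2) ^ (α : ℂ) *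
        modBesselJ2 α q z := by
  have h2 : z / 2 ≠ 0 := div_ne_zero hz two_ne_zero
  unfold besselJ2 modBesselJ2
  rw [mul_assoc]
  refine congrArg _ ?_
  rw [← tsum_mul_left]
  refine tsum_congr fun n => ?_
  have : (z / 2) ^ (2 * (n : ℂ) + (α : ℂ)) = (z / 2) ^ (α : ℂ) * (z / 2) ^ (2 * n) := by
    rw [Complex.cpow_add _ _ h2, mul_comm]
    congr 1
    exact_mod_cast Complex.cpow_natCast (z / 2) (2 * n)
  rw [this]
  ring

/-- The function `g_α^{(2)}(t;q) = 𝒥_α^{(2)}(t(1-q);q²)`. -/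
def g2 (α q : ℝ) (t : ℂ) : ℂ := modBesselJ2 α (q ^ 2) (t * (1 - (q : ℂ)))

/-- The generating function `E_q(zt) E_q(-t/2) / g_α^{(2)}(it;q)` of the generalized
`q`-Bernoulli polynomials of the second kind, as a function of `t`. -/
def genFun (α q : ℝ) (z t : ℂ) : ℂ :=
  bigEq q (z * t) * bigEq q (-t / 2) / g2 α q (Complex.I * t)

/-- The generalized `q`-Bernoulli polynomials `B_{n,α}^{(2)}(z;q)`, defined by
`E_q(zt) E_q(-t/2) / g_α^{(2)}(it;q) = ∑ B_{n,α}^{(2)}(z;q) t^n / [n]_q!`, that is,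
`B_{n,α}^{(2)}(z;q) / [n]_q!` is the `n`-th Taylor coefficient at `t = 0`. -/
def bernoulliB2 (α q : ℝ) (n : ℕ) (z : ℂ) : ℂ :=
  (qFact q n : ℂ) * (iteratedDeriv n (genFun α q z) 0 / (n.factorial : ℂ))

/-- `j` is the smallest positive zero of `J_α^{(2)}(·;q²)`. -/
def IsFirstZero (α q j : ℝ) : Prop :=
  IsLeast {x : ℝ | 0 < x ∧ besselJ2 α (q ^ 2) (x : ℂ) = 0} j

/-- `Ψ_n = q^{n(n-1)/2} / [n]_q!`. -/
def Psi (q : ℝ) (n : ℕ) : ℝ := q ^ (n * (n - 1) / 2) / qFact q n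

/-- The quotient `(q^{2α+1};q²)_m / (q^{2α+1};q)_m`. At `α = -1/2`, where it is formally `0/0` for
`m ≥ 1`, it stands for its limit as `α → -1/2`, which is `(-q;q)_{m-1}` for `m ≥ 1`
(and `1` for `m = 0`); see `pochRatio_continuousAt`. -/
def pochRatio (α q : ℝ) (m : ℕ) : ℝ :=
  if α = -1 / 2 then (if m = 0 then 1 else qPoch (-q) q (m - 1))
  else qPoch (q ^ (2 * α + 1)) (q ^ 2) m / qPoch (q ^ (2 * α + 1)) q m

theorem pochRatio_continuousAt {q : ℝ} (hq0 : 0 < q) (hq1 : q < 1) (m : ℕ) :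
    ContinuousAt (fun α => pochRatio α q m) (-1 / 2) := by
  rcases m with _ | m
  · have : (fun α => pochRatio α q 0) = fun _ => 1 := by
      funext α
      simp [pochRatio, qPoch]
    rw [this]
    exact continuousAt_const
  · have hpos : ∀ k : ℕ, (1 - q ^ (k + 1)) ≠ 0 := fun k =>
      (sub_pos.2 (pow_lt_one₀ hq0.le hq1 (Nat.succ_ne_zero k))).ne'
    have key : (fun α => pochRatio α q (m + 1)) = fun α =>
        (∏ k ∈ Finset.range m, (1 - q ^ (2 * α + 1) * (q ^ 2) ^ (k + 1))) /
          ∏ k ∈ Finset.range m, (1 - q ^ (2 * α + 1) * q ^ (k + 1)) := by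
      funext α
      by_cases h : α = -1 / 2
      · subst h
        have h0 : (2 * (-1 / 2 : ℝ) + 1) = 0 := by norm_num
        simp only [pochRatio, if_true, h0, Real.rpow_zero, qPoch, Nat.succ_ne_zero, if_false,
          Nat.add_sub_cancel]
        rw [← Finset.prod_div_distrib]
        refine Finset.prod_congr rfl fun k _ => ?_
        rw [one_mul, one_mul, eq_div_iff (hpos k)]
        ring
      · have hne : (1 - q ^ (2 * α + 1)) ≠ 0 := by
          intro h1
          have h2 : q ^ (2 * α + 1) = q ^ (0 : ℝ) := by rw [Real.rpow_zero]; linarith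
          have h3 := (Real.rpow_right_inj hq0 hq1.ne).1 h2
          exact h (by linarith)
        simp only [pochRatio, if_neg h, qPoch]
        rw [Finset.prod_range_succ', Finset.prod_range_succ']
        simp only [pow_zero, mul_one]
        rw [mul_div_mul_right _ _ hne]
    rw [key]
    have hc : ContinuousAt (fun α : ℝ => q ^ (2 * α + 1)) (-1 / 2) :=
      ContinuousAt.rpow continuousAt_const (by fun_prop) (Or.inl hq0.ne')
    refine ContinuousAt.div ?_ ?_ ?_
    · exact tendsto_finsetProd _ fun k _ => (continuousAt_const.sub (hc.mul continuousAt_const))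
    · exact tendsto_finsetProd _ fun k _ => (continuousAt_const.sub (hc.mul continuousAt_const))
    · rw [Finset.prod_ne_zero_iff]
      intro k _
      have h0 : (2 * (-1 / 2 : ℝ) + 1) = 0 := by norm_num
      rw [h0, Real.rpow_zero, one_mul]
      exact hpos k

/-- The `k`-th term of the series that defines the coefficient `L_n(f)` (used for `k ≥ n`), where
`a k` is the `k`-th Taylor coefficient of `f`. -/
def coeffTerm (α q : ℝ) (a : ℕ → ℂ) (n k : ℕ) : ℂ :=
  a k * (((q ^ (k * (k - 1) / 2))⁻¹ * qPoch q q k * pochRatio α q (k - n) *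
    (1 / 2) ^ (k - n) / qPoch q q (k - n) : ℝ) : ℂ)

/-- The coefficient
`L_n(f) = (1-q)^{-n} ∑_{k ≥ n} f_k q^{-k(k-1)/2} (q;q)_k (q^{2α+1};q²)_{k-n} (1/2)^{k-n} /
  ((q;q)_{k-n} (q^{2α+1};q)_{k-n})`. -/
def coeffL (α q : ℝ) (a : ℕ → ℂ) (n : ℕ) : ℂ :=
  (((1 - q) ^ n)⁻¹ : ℝ) * ∑' k : Set.Ici n, coeffTerm α q a n k

end QBernoulli

end

/-! ### Power series that sum to a function on a disc. -/

namespace QBernoulli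

/-! Put `D(t) = g(it) / E_q(-t/2) = ∑ d_m t^m`. Multiplying the generating function of the `B_n` by
`D` leaves `E_q(zt) = ∑ Ψ_k z^k t^k`, so `Ψ_k z^k = ∑_{n+m=k} (B_n(z)/[n]_q!) d_m`. Inserting this
into `f(z) = ∑ (f_k/Ψ_k) Ψ_k z^k` and exchanging the sums gives the expansion, with coefficients
`L_n(f) = ∑_m (f_{n+m}/Ψ_{n+m}) d_m`. The exchange is legitimate as soon as some `ρ > τ` lies inside
the discs of convergence of both `D` and the generating function.

Two facts carry the proof.

(1) The closed form of `d_m`, with radius at least `2/(1-q)`. In the variable `x = (1-q)t/2` the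
factor `E_q(-t/2)` is `(x;q)_∞`. The recurrence of the proposed coefficients is a `q`-difference
equation; multiplied by `(x;q)_∞` it relates only coefficients two apart, and it becomes the
recurrence of the Bessel series (`coeff_eulerSeries_mul`, `bigEq_mul_quotient`).

(2) `g(it)` has no complex zero with `|t| < j/(1-q)` (`g2_ne_zero`). Reality of the zeros is not
used. The three-term relation in `α` gives a continued fraction with nonnegative coefficients, so
the reciprocal of the Bessel series in `z²/4` has nonnegative Taylor coefficients. By a Pringsheim
argument, a positive number is then among the zeros of least modulus
(`ne_zero_of_coeff_inv_nonneg`). -/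

open PowerSeries in
/-- The power series `P` sums to `F` on the open disc of radius `R` around `0`. -/
def SumsTo (P : PowerSeries ℂ) (F : ℂ → ℂ) (R : ℝ) : Prop :=
  ∀ t : ℂ, ‖t‖ < R → HasSum (fun n => coeff n P * t ^ n) (F t)

namespace SumsTo

variable {P Q : PowerSeries ℂ} {F G : ℂ → ℂ} {R : ℝ}

theorem mono (h : SumsTo P F R) {R' : ℝ} (hR : R' ≤ R) : SumsTo P F R' :=
  fun t ht => h t (ht.trans_le hR)

theorem congr (h : SumsTo P F R) (hFG : ∀ t : ℂ, ‖t‖ < R → F t = G t) : SumsTo P G R :=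
  fun t ht => hFG t ht ▸ h t ht

theorem summable_norm (h : SumsTo P F R) {t : ℂ} (ht : ‖t‖ < R) :
    Summable fun n => ‖PowerSeries.coeff n P * t ^ n‖ :=
  (h t ht).summable.norm

theorem hasFPowerSeriesOnBall (h : SumsTo P F R) (hR : 0 < R) :
    HasFPowerSeriesOnBall F
      (FormalMultilinearSeries.ofScalars ℂ fun n => PowerSeries.coeff n P) 0
      (ENNReal.ofReal R) where
  r_le := by
    refine ENNReal.le_of_forall_nnreal_lt fun r hr => ?_
    have hr' : (r : ℝ) < R := by
      rw [← ENNReal.ofReal_coe_nnreal, ENNReal.ofReal_lt_ofReal_iff hR] at hr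
      exact hr
    refine FormalMultilinearSeries.le_radius_of_summable _ ?_
    have := h.summable_norm (t := (r : ℝ)) (by simpa using hr')
    refine this.congr fun n => ?_
    rw [FormalMultilinearSeries.ofScalars_norm]
    simp
  r_pos := by simpa using hR
  hasSum := by
    intro y hy
    have hy' : ‖y‖ < R := by
      rw [Metric.eball_ofReal] at hy
      simpa using hy
    simpa [FormalMultilinearSeries.ofScalars_apply_eq, mul_comm] using h y hy'

theorem differentiableOn (h : SumsTo P F R) (hR : 0 < R) :
    DifferentiableOn ℂ F (Metric.ball 0 R) := by
  have := (h.hasFPowerSeriesOnBall hR).differentiableOn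
  rwa [Metric.eball_ofReal] at this

theorem unique (h : SumsTo P F R) (h' : SumsTo Q F R) (hR : 0 < R) : P = Q := by
  have h1 := (h.hasFPowerSeriesOnBall hR).hasFPowerSeriesAt.eq_formalMultilinearSeries
    (h'.hasFPowerSeriesOnBall hR).hasFPowerSeriesAt
  have h2 := FormalMultilinearSeries.ofScalars_series_injective ℂ ℂ h1
  ext n
  exact congrFun h2 n

theorem mul (h : SumsTo P F R) (h' : SumsTo Q G R) : SumsTo (P * Q) (fun t => F t * G t) R := by
  intro t ht
  have hs := summable_norm_sum_mul_antidiagonal_of_summable_norm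
    (h.summable_norm ht) (h'.summable_norm ht)
  have he := tsum_mul_tsum_eq_tsum_sum_antidiagonal_of_summable_norm
    (h.summable_norm ht) (h'.summable_norm ht)
  rw [(h t ht).tsum_eq, (h' t ht).tsum_eq] at he
  change HasSum _ (F t * G t)
  rw [he]
  refine hs.of_norm.hasSum.congr_fun fun n => ?_
  rw [PowerSeries.coeff_mul, Finset.sum_mul]
  refine Finset.sum_congr rfl fun x hx => ?_
  rw [← Finset.HasAntidiagonal.mem_antidiagonal.1 hx, pow_add]
  ring

theorem one : SumsTo 1 (fun _ => 1) R := by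
  intro t _
  convert hasSum_single 0 ?_ using 1
  · simp
  · intro n hn
    simp [PowerSeries.coeff_one, hn]

theorem taylor (hF : DifferentiableOn ℂ F (Metric.ball 0 R)) :
    SumsTo (PowerSeries.mk fun n => iteratedDeriv n F 0 / (n.factorial : ℂ)) F R := by
  intro t ht
  have := Complex.hasSum_taylorSeries_on_ball hF (z := t) (by simpa using ht)
  refine this.congr_fun fun n => ?_
  simp only [PowerSeries.coeff_mk, smul_eq_mul, sub_zero]
  ring

/-- Rescaling of the variable. -/
theorem rescale (h : SumsTo P F R) (c : ℂ) {R' : ℝ} (hc : ‖c‖ * R' ≤ R) (hc0 : c ≠ 0) :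
    SumsTo (PowerSeries.rescale c P) (fun t => F (c * t)) R' := by
  intro t ht
  have hlt : ‖c * t‖ < R := by
    rw [norm_mul]
    exact (mul_lt_mul_of_pos_left ht (norm_pos_iff.2 hc0)).trans_le hc
  refine (h _ hlt).congr_fun fun n => ?_
  rw [PowerSeries.coeff_rescale, mul_pow]
  ring

end SumsTo

theorem summable_of_recurrence {c ρ : ℕ → ℂ} {l : ℂ} (hc : ∀ n, c (n + 1) = ρ n * c n)
    (hρ : Tendsto ρ atTop (𝓝 l)) {t : ℂ} (ht : ‖l‖ * ‖t‖ < 1) :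
    Summable fun n => c n * t ^ n := by
  obtain ⟨r, hr, hr1⟩ := exists_between ht
  refine summable_of_ratio_norm_eventually_le hr1 ?_
  have h1 : Tendsto (fun n => ‖ρ n‖ * ‖t‖) atTop (𝓝 (‖l‖ * ‖t‖)) := hρ.norm.mul_const _
  filter_upwards [h1.eventually (gt_mem_nhds hr)] with n hn
  rw [hc, pow_succ, show ρ n * c n * (t ^ n * t) = ρ n * t * (c n * t ^ n) by ring, norm_mul,
    norm_mul]
  exact mul_le_mul_of_nonneg_right hn.le (norm_nonneg _)

end QBernoulli

/-! ### Reciprocals with nonnegative coefficients, and zeros of least modulus. -/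

namespace QBernoulli

open PowerSeries

/-- If `u k = u (k + 1) - c k X u (k + 2)` with `c k ≥ 0`, then the quotients `u (k + 1) / u k`
have nonnegative coefficients (they are Stieltjes continued fractions). -/
theorem coeff_mul_inv_nonneg {u : ℕ → PowerSeries ℝ} {c : ℕ → ℝ} (hc : ∀ k, 0 ≤ c k)
    (h0 : ∀ k, constantCoeff (u k) = 1)
    (hrec : ∀ k, u k = u (k + 1) - C (c k) * X * u (k + 2)) (n : ℕ) :
    ∀ k, 0 ≤ coeff n (u (k + 1) * (u k)⁻¹) := by
  have hne : ∀ k, constantCoeff (u k) ≠ 0 := fun k => by rw [h0]; exact one_ne_zero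
  -- With `R_k = u_{k+1}/u_k` the recurrence reads `R_k = 1 + c_k X R_k R_{k+1}`. The factor `X`
  -- makes each coefficient depend only on earlier ones, so induction works for all `k` at once.
  have hR : ∀ k, u (k + 1) * (u k)⁻¹ =
      1 + C (c k) * (X * ((u (k + 1) * (u k)⁻¹) * (u (k + 2) * (u (k + 1))⁻¹))) := by
    intro k
    have e1 := PowerSeries.mul_inv_cancel _ (hne k)
    have e2 := PowerSeries.mul_inv_cancel _ (hne (k + 1))
    linear_combination (-(u k)⁻¹) * hrec k + e1 -
      C (c k) * X * (u k)⁻¹ * u (k + 2) * e2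
  induction n using Nat.strong_induction_on with
  | _ n ih =>
    intro k
    rw [hR]
    rcases n with _ | n
    · simp
    · rw [map_add, coeff_C_mul, coeff_succ_X_mul, coeff_mul, coeff_one, if_neg n.succ_ne_zero,
        zero_add]
      refine mul_nonneg (hc k) (Finset.sum_nonneg fun x hx => ?_)
      have := Finset.HasAntidiagonal.mem_antidiagonal.1 hx
      exact mul_nonneg (ih _ (by omega) k) (ih _ (by omega) (k + 1))

theorem tendsto_coeff_inv {u : ℕ → PowerSeries ℝ} (h0 : ∀ k, constantCoeff (u k) = 1)
    (hlim : ∀ n, n ≠ 0 → Tendsto (fun k => coeff n (u k)) atTop (𝓝 0)) (n : ℕ) :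
    Tendsto (fun k => coeff n (u k)⁻¹) atTop (𝓝 (if n = 0 then 1 else 0)) := by
  induction n using Nat.strong_induction_on with
  | _ n ih =>
    by_cases hn : n = 0
    · subst hn
      simp [h0]
    · simp_rw [fun k => coeff_inv n (u k), if_neg hn, h0]
      have key : Tendsto (fun k => ∑ x ∈ Finset.HasAntidiagonal.antidiagonal n,
          if x.2 < n then coeff x.1 (u k) * coeff x.2 (u k)⁻¹ else 0) atTop
          (𝓝 (∑ x ∈ Finset.HasAntidiagonal.antidiagonal n, 0)) := by
        refine tendsto_finsetSum _ fun x hx => ?_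
        split_ifs with hx2
        · have h1 := (hlim x.1 (by have := Finset.HasAntidiagonal.mem_antidiagonal.1 hx; omega)).mul (ih x.2 hx2)
          simpa using h1
        · exact tendsto_const_nhds
      simpa using key.neg

/-- Since `1/u_k - 1/u_{k+1} = c_k X (1/u_k)(u_{k+2}/u_{k+1})`, each coefficient of `1/u_k` of
positive degree decreases in `k` once the earlier ones are known to be nonnegative. Its limit is `0`
because `u_k → 1` coefficientwise, so it is nonnegative for every `k`. -/
theorem coeff_inv_nonneg {u : ℕ → PowerSeries ℝ} {c : ℕ → ℝ} (hc : ∀ k, 0 ≤ c k)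
    (h0 : ∀ k, constantCoeff (u k) = 1)
    (hrec : ∀ k, u k = u (k + 1) - C (c k) * X * u (k + 2))
    (hlim : ∀ n, n ≠ 0 → Tendsto (fun k => coeff n (u k)) atTop (𝓝 0)) (n : ℕ) :
    ∀ k, 0 ≤ coeff n (u k)⁻¹ := by
  have hne : ∀ k, constantCoeff (u k) ≠ 0 := fun k => by rw [h0]; exact one_ne_zero
  have hV : ∀ k, (u k)⁻¹ =
      (u (k + 1))⁻¹ + C (c k) * (X * ((u k)⁻¹ * (u (k + 2) * (u (k + 1))⁻¹))) := by
    intro k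
    have e1 := PowerSeries.mul_inv_cancel _ (hne k)
    have e2 := PowerSeries.mul_inv_cancel _ (hne (k + 1))
    linear_combination (-(u k)⁻¹ * (u (k + 1))⁻¹) * hrec k + (u (k + 1))⁻¹ * e1 - (u k)⁻¹ * e2
  induction n using Nat.strong_induction_on with
  | _ n ih =>
    rcases n with _ | n
    · intro k
      simp [h0]
    · have hanti : Antitone fun k => coeff (n + 1) (u k)⁻¹ := by
        refine antitone_nat_of_succ_le fun k => ?_
        conv_rhs => rw [hV k]
        rw [map_add, coeff_C_mul, coeff_succ_X_mul, coeff_mul]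
        refine le_add_of_nonneg_right (mul_nonneg (hc k) (Finset.sum_nonneg fun x hx => ?_))
        have := Finset.HasAntidiagonal.mem_antidiagonal.1 hx
        exact mul_nonneg (ih _ (by omega) k) (coeff_mul_inv_nonneg hc h0 hrec _ (k + 1))
      intro k
      have ht := tendsto_coeff_inv h0 hlim (n + 1)
      rw [if_neg n.succ_ne_zero] at ht
      exact hanti.le_of_tendsto ht k

/-- An entire function whose reciprocal has nonnegative Taylor coefficients at `0` has a positive
zero among its zeros of least modulus. -/
theorem ne_zero_of_coeff_inv_nonneg {u : PowerSeries ℝ} (h0 : constantCoeff u = 1)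
    (hnn : ∀ n, 0 ≤ coeff n u⁻¹) {h : ℂ → ℂ}
    (hh : ∀ R, SumsTo (u.map Complex.ofRealHom) h R) {W : ℝ}
    (hpos : ∀ x : ℝ, 0 < x → x < W → h x ≠ 0) {w : ℂ} (hw : ‖w‖ < W) : h w ≠ 0 := by
  intro hw0
  have hdiff : Differentiable ℂ h := fun z =>
    ((hh (‖z‖ + 1)).differentiableOn (by positivity)).differentiableAt
      (Metric.isOpen_ball.mem_nhds (by simp))
  have hcont := hdiff.continuous
  have hone : h 0 = 1 := by
    have h1 := hh 1 0 (by simp)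
    refine h1.unique ?_
    convert hasSum_single 0 ?_ using 1
    · simp [h0]
    · intro n hn
      simp [hn]
  -- Compactness yields a zero `w0` of least modulus; then `1/h` is holomorphic on `|z| < |w0|`,
  -- with the formal inverse of `u` as its Taylor series.
  have hcpt : IsCompact (Metric.closedBall (0 : ℂ) ‖w‖ ∩ h ⁻¹' {0}) :=
    (isCompact_closedBall _ _).inter_right (isClosed_singleton.preimage hcont)
  obtain ⟨w0, ⟨hw0b, hw0z⟩, hmin⟩ := hcpt.exists_isMinOn ⟨w, by simp, hw0⟩
    (continuous_norm.continuousOn)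
  have hw0z : h w0 = 0 := hw0z
  have hw0le : ‖w0‖ ≤ ‖w‖ := by simpa using hw0b
  have hw0ne : w0 ≠ 0 := by
    rintro rfl
    rw [hone] at hw0z
    exact one_ne_zero hw0z
  have hρ : 0 < ‖w0‖ := norm_pos_iff.2 hw0ne
  have hnz : ∀ z : ℂ, ‖z‖ < ‖w0‖ → h z ≠ 0 := by
    intro z hz hz0
    have : ‖w0‖ ≤ ‖z‖ := hmin (a := z) ⟨by simpa using hz.le.trans hw0le, hz0⟩
    exact absurd hz this.not_gt
  have hinv : SumsTo (u⁻¹.map Complex.ofRealHom) (fun z => (h z)⁻¹) ‖w0‖ := by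
    have hT := SumsTo.taylor (F := fun z => (h z)⁻¹) (R := ‖w0‖)
      (hdiff.differentiableOn.inv fun z hz => hnz z (by simpa using hz))
    have hprod := ((hh ‖w0‖).mul hT).congr (G := fun _ => 1)
      fun t ht => mul_inv_cancel₀ (hnz t ht)
    have e1 := hprod.unique SumsTo.one hρ
    have e2 : u.map Complex.ofRealHom * u⁻¹.map Complex.ofRealHom = 1 := by
      rw [← map_mul, PowerSeries.mul_inv_cancel _ (by rw [h0]; exact one_ne_zero), map_one]
    have e3 := left_inv_eq_right_inv ((mul_comm _ _).trans e1) e2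
    rwa [e3] at hT
  -- Nonnegative coefficients make `|1/h|` on a circle largest at its positive point. As `s → 1` the
  -- right side tends to `h w0 = 0`, which forces a zero at the positive number `‖w0‖ < W`.
  have hle : ∀ s : ℝ, s ∈ Set.Ioo (0 : ℝ) 1 → ‖h ((s * ‖w0‖ : ℝ) : ℂ)‖ ≤ ‖h (s * w0)‖ := by
    intro s hs
    have hlt : s * ‖w0‖ < ‖w0‖ := mul_lt_of_lt_one_left hρ hs.2
    have hn1 : ‖((s * ‖w0‖ : ℝ) : ℂ)‖ = s * ‖w0‖ := by
      rw [Complex.norm_real, Real.norm_of_nonneg (mul_nonneg hs.1.le hρ.le)]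
    have hn2 : ‖(s : ℂ) * w0‖ = s * ‖w0‖ := by
      rw [norm_mul, Complex.norm_real, Real.norm_of_nonneg hs.1.le]
    have h1 : HasSum _ (h ((s * ‖w0‖ : ℝ) : ℂ))⁻¹ := hinv _ (hn1.trans_lt hlt)
    have h2 : HasSum _ (h ((s : ℂ) * w0))⁻¹ := hinv _ (hn2.trans_lt hlt)
    have hn : ∀ n, ‖coeff n (u⁻¹.map Complex.ofRealHom) * ((s : ℂ) * w0) ^ n‖ =
        coeff n u⁻¹ * (s * ‖w0‖) ^ n := by
      intro n
      rw [norm_mul, norm_pow, hn2, coeff_map, Complex.ofRealHom_eq_coe, Complex.norm_real,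
        Real.norm_of_nonneg (hnn n)]
    have hsum := h2.summable.norm
    have h3 : ‖(h ((s : ℂ) * w0))⁻¹‖ ≤ ∑' n, coeff n u⁻¹ * (s * ‖w0‖) ^ n := by
      rw [← h2.tsum_eq]
      exact (norm_tsum_le_tsum_norm hsum).trans_eq (tsum_congr hn)
    have h4 : (h ((s * ‖w0‖ : ℝ) : ℂ))⁻¹ =
        ((∑' n, coeff n u⁻¹ * (s * ‖w0‖) ^ n : ℝ) : ℂ) := by
      rw [← h1.tsum_eq, Complex.ofReal_tsum]
      refine tsum_congr fun n => ?_
      simp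
    have h5 : ‖(h ((s : ℂ) * w0))⁻¹‖ ≤ ‖(h ((s * ‖w0‖ : ℝ) : ℂ))⁻¹‖ := by
      rw [h4, Complex.norm_real]
      exact h3.trans (le_abs_self _)
    rw [norm_inv, norm_inv] at h5
    exact (inv_le_inv₀ (norm_pos_iff.2 (hnz _ (hn2.trans_lt hlt)))
      (norm_pos_iff.2 (hnz _ (hn1.trans_lt hlt)))).1 h5
  have hmem : Set.Ioo (0 : ℝ) 1 ∈ 𝓝[<] (1 : ℝ) := Ioo_mem_nhdsLT one_pos
  have hl : Tendsto (fun s : ℝ => ‖h ((s * ‖w0‖ : ℝ) : ℂ)‖) (𝓝[<] 1)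
      (𝓝 ‖h ((1 * ‖w0‖ : ℝ) : ℂ)‖) :=
    (Continuous.tendsto (by fun_prop) 1).mono_left nhdsWithin_le_nhds
  have hr : Tendsto (fun s : ℝ => ‖h (s * w0)‖) (𝓝[<] 1) (𝓝 ‖h ((1 : ℝ) * w0)‖) :=
    (Continuous.tendsto (f := fun s : ℝ => ‖h (s * w0)‖) (by fun_prop) 1).mono_left
      nhdsWithin_le_nhds
  have hfin := le_of_tendsto_of_tendsto hl hr (eventually_of_mem hmem hle)
  rw [Complex.ofReal_one, one_mul, one_mul, hw0z, norm_zero] at hfin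
  exact hpos ‖w0‖ hρ (hw0le.trans_lt hw) (norm_le_zero_iff.1 hfin)

end QBernoulli

/-! ### `q`-shifted factorials and the power series of the `q`-Bessel function. -/

namespace QBernoulli

open PowerSeries

theorem qPoch_succ (a q : ℝ) (n : ℕ) : qPoch a q (n + 1) = qPoch a q n * (1 - a * q ^ n) :=
  Finset.prod_range_succ _ _

theorem qPoch_succ' (a q : ℝ) (n : ℕ) : qPoch a q (n + 1) = (1 - a) * qPoch (a * q) q n := by
  unfold qPoch
  rw [Finset.prod_range_succ', mul_comm, pow_zero, mul_one]
  refine congrArg _ (Finset.prod_congr rfl fun k _ => ?_)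
  ring

theorem qPoch_pos {a q : ℝ} (ha : a < 1) (hq0 : 0 < q) (hq1 : q < 1) (n : ℕ) :
    0 < qPoch a q n := by
  refine Finset.prod_pos fun k _ => sub_pos.2 ?_
  rcases le_or_gt a 0 with h | h
  · exact (mul_nonpos_of_nonpos_of_nonneg h (by positivity)).trans_lt one_pos
  · exact (mul_le_of_le_one_right h.le (pow_le_one₀ hq0.le hq1.le)).trans_lt ha

theorem qFact_eq {q : ℝ} (hq1 : q < 1) (n : ℕ) : qFact q n = qPoch q q n / (1 - q) ^ n := by
  have h : (1 - q) ≠ 0 := (sub_pos.2 hq1).ne'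
  unfold qFact qPoch qNat
  rw [Finset.prod_div_distrib, Finset.prod_const, Finset.card_range]
  refine congrArg (· / _) (Finset.prod_congr rfl fun k _ => ?_)
  ring

/-- The power series `∑ (-1)^n p^{n²} b^n / ((p;p)_n (bp;p)_n) X^n`, which for `b = p^α` is
`𝒥_α^{(2)}(z;p)` in the variable `X = z² / 4`. -/
noncomputable def besselSeries (p b : ℝ) : PowerSeries ℝ :=
  PowerSeries.mk fun n =>
    (-1) ^ n * (p ^ (n ^ 2) * b ^ n / (qPoch p p n * qPoch (b * p) p n))

section Bessel

variable {p b : ℝ}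

theorem constantCoeff_besselSeries : constantCoeff (besselSeries p b) = 1 := by
  rw [← coeff_zero_eq_constantCoeff_apply]
  simp [besselSeries, qPoch]

theorem coeff_succ_besselSeries (hp0 : 0 < p) (hp1 : p < 1) (hb : b * p < 1) (n : ℕ) :
    coeff (n + 1) (besselSeries p b) =
      -(p ^ (2 * n + 1) * b / ((1 - p ^ (n + 1)) * (1 - b * p * p ^ n))) *
        coeff n (besselSeries p b) := by
  have h1 := (qPoch_pos hp1 hp0 hp1 n).ne'
  have h2 := (qPoch_pos hb hp0 hp1 n).ne'
  have h3 := (qPoch_pos hp1 hp0 hp1 (n + 1)).ne'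
  have h4 := (qPoch_pos hb hp0 hp1 (n + 1)).ne'
  rw [qPoch_succ] at h3 h4
  have h5 := right_ne_zero_of_mul h3
  have h6 := right_ne_zero_of_mul h4
  have e : p ^ (n + 1) = p * p ^ n := pow_succ' _ _
  simp only [besselSeries, coeff_mk, qPoch_succ]
  rw [e]
  field_simp
  ring

/-- Replacing `b` by `b * p` raises `α` by one, so this is a contiguous relation in the order. Its
`X`-coefficient is positive, as the continued fraction requires. -/
theorem besselSeries_three_term (hp0 : 0 < p) (hp1 : p < 1) (hb0 : 0 < b) (hb : b * p < 1) :
    besselSeries p b = besselSeries p (b * p) -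
      C (b * p / ((1 - b * p) * (1 - b * p * p))) * X * besselSeries p (b * p * p) := by
  have hbp : b * p * p < 1 := (mul_lt_of_lt_one_right (by positivity) hp1).trans hb
  have hbpp : b * p * p * p < 1 := (mul_lt_of_lt_one_right (by positivity) hp1).trans hbp
  ext n
  rcases n with _ | n
  · simp [besselSeries, qPoch, mul_assoc]
  · rw [map_sub, mul_assoc, coeff_C_mul, coeff_succ_X_mul]
    have hP := (qPoch_pos hp1 hp0 hp1 (n + 1)).ne'
    have hQ := (qPoch_pos hbpp hp0 hp1 n).ne'
    have hD := (qPoch_pos hb hp0 hp1 (n + 1)).ne'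
    have ha1 : 1 - b * p ≠ 0 := (sub_pos.2 hb).ne'
    have ha2 : 1 - b * p * p ≠ 0 := (sub_pos.2 hbp).ne'
    -- The product of length `n + 2` is split off at its last factor and at its first two, so that
    -- all three series share one factorial.
    have hE : qPoch (b * p) p (n + 1) * (1 - b * p * p ^ (n + 1)) =
        (1 - b * p) * ((1 - b * p * p) * qPoch (b * p * p * p) p n) := by
      rw [← qPoch_succ, qPoch_succ', qPoch_succ']
    have hn : 1 - b * p * p ^ (n + 1) ≠ 0 := fun h => by
      rw [h, mul_zero] at hE
      exact mul_ne_zero ha1 (mul_ne_zero ha2 hQ) hE.symm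
    have hD' : qPoch (b * p) p (n + 1) = (1 - b * p) * ((1 - b * p * p) *
        qPoch (b * p * p * p) p n) / (1 - b * p * p ^ (n + 1)) := by
      rw [eq_div_iff hn, hE]
    simp only [besselSeries, coeff_mk]
    rw [hD', qPoch_succ' (b * p * p), qPoch_succ p]
    rw [qPoch_succ] at hP
    have hP1 := left_ne_zero_of_mul hP
    have hP2 := right_ne_zero_of_mul hP
    clear hD' hE hD
    generalize qPoch (b * p * p * p) p n = Q at *
    obtain ⟨y, hy⟩ : ∃ y, y = 1 - b * p * p := ⟨_, rfl⟩
    obtain ⟨z, hz⟩ : ∃ z, z = 1 - b * p * p ^ (n + 1) := ⟨_, rfl⟩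
    obtain ⟨x, hx⟩ : ∃ x, x = 1 - b * p := ⟨_, rfl⟩
    rw [← hx] at ha1
    rw [← hy] at ha2
    rw [← hz] at hn
    rw [← hx, ← hy, ← hz]
    field_simp
    rw [hz, hx]
    ring

theorem coeff_inv_besselSeries_nonneg (hp0 : 0 < p) (hp1 : p < 1) (hb0 : 0 < b)
    (hb : b * p < 1) (n : ℕ) : 0 ≤ coeff n (besselSeries p b)⁻¹ := by
  have hb' : ∀ k : ℕ, b * p ^ k * p < 1 := fun k => by
    refine lt_of_le_of_lt ?_ hb
    rw [mul_right_comm]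
    exact mul_le_of_le_one_right (by positivity) (pow_le_one₀ hp0.le hp1.le)
  have hb2 : ∀ k : ℕ, b * p ^ k * p * p < 1 := fun k =>
    (mul_lt_of_lt_one_right (by positivity) hp1).trans (hb' k)
  have key := coeff_inv_nonneg (u := fun k => besselSeries p (b * p ^ k))
    (c := fun k => b * p ^ k * p / ((1 - b * p ^ k * p) * (1 - b * p ^ k * p * p)))
    (fun k => div_nonneg (by positivity)
      (mul_nonneg (sub_pos.2 (hb' k)).le (sub_pos.2 (hb2 k)).le))
    (fun k => constantCoeff_besselSeries)
    (fun k => by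
      have := besselSeries_three_term hp0 hp1 (mul_pos hb0 (pow_pos hp0 k)) (hb' k)
      simpa only [pow_succ, ← mul_assoc] using this) ?_ n 0
  · simpa using key
  -- As `k → ∞` the parameter `b p^k` tends to `0`, and the factor `(b p^k)^m` kills every
  -- coefficient with `m ≠ 0`.
  · intro m hm
    have h0 : Tendsto (fun k : ℕ => p ^ k) atTop (𝓝 0) :=
      tendsto_pow_atTop_nhds_zero_of_lt_one hp0.le hp1
    have hc : ContinuousAt (fun x : ℝ => (-1) ^ m *
        (p ^ (m ^ 2) * (b * x) ^ m / (qPoch p p m * qPoch (b * x * p) p m))) 0 := by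
      refine continuousAt_const.mul (ContinuousAt.div (by fun_prop) ?_ ?_)
      · unfold qPoch
        fun_prop
      · have := (qPoch_pos hp1 hp0 hp1 m).ne'
        simpa [qPoch] using this
    have := hc.tendsto.comp h0
    simpa [besselSeries, Function.comp_def, hm] using this

end Bessel

/-! ### Euler's product and the `q`-difference equation. -/

section Product

variable {q b : ℝ}

/-- The power series `(x;q)_∞ = ∑ (-1)^k q^{k(k-1)/2} x^k / (q;q)_k`. -/
noncomputable def eulerSeries (q : ℝ) : PowerSeries ℝ :=
  PowerSeries.mk fun k => (-1) ^ k * (q ^ (k * (k - 1) / 2) / qPoch q q k)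

theorem constantCoeff_rescale (a : ℝ) (f : PowerSeries ℝ) :
    constantCoeff (rescale a f) = constantCoeff f := by
  rw [← coeff_zero_eq_constantCoeff_apply, coeff_rescale, pow_zero, one_mul,
    coeff_zero_eq_constantCoeff_apply]

theorem triangle_succ (k : ℕ) : (k + 1) * (k + 1 - 1) / 2 = k * (k - 1) / 2 + k := by
  rw [← Nat.choose_two_right, ← Nat.choose_two_right, Nat.choose_succ_succ' k 1,
    Nat.choose_one_right, add_comm]

/-- This is `(x;q)_∞ = (1 - x)(qx;q)_∞`; the operation `rescale q` substitutes `qx` for `x`. -/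
theorem eulerSeries_eq (hq0 : 0 < q) (hq1 : q < 1) :
    eulerSeries q = (1 - X) * rescale q (eulerSeries q) := by
  ext n
  rcases n with _ | n
  · simp [sub_mul, constantCoeff_rescale]
  · rw [sub_mul, one_mul, map_sub, coeff_succ_X_mul, coeff_rescale, coeff_rescale]
    have h3 := (qPoch_pos hq1 hq0 hq1 (n + 1)).ne'
    rw [qPoch_succ] at h3
    have h4 := left_ne_zero_of_mul h3
    have h5 := right_ne_zero_of_mul h3
    simp only [eulerSeries, coeff_mk, qPoch_succ, triangle_succ]
    field_simp
    ring

/-- If `F` has coefficients with `φ_{m+1} (1 - q^{m+1}) (1 - b q^{m+1}) = (1 - b q^{2m+1}) φ_m`,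
then `(X;q)_∞ F` satisfies the `q`-difference equation of the second Jackson `q`-Bessel function. -/
theorem coeff_eulerSeries_mul (hq0 : 0 < q) (hq1 : q < 1) {φ : ℕ → ℝ}
    (hφ : ∀ m, φ (m + 1) * ((1 - q ^ (m + 1)) * (1 - b * q ^ (m + 1))) =
      (1 - b * q ^ (2 * m + 1)) * φ m) (n : ℕ) :
    coeff (n + 2) (eulerSeries q * PowerSeries.mk φ) *
      ((1 - q ^ (n + 2)) * (1 - b * q ^ (n + 2))) =
      b * q ^ (2 * n + 2) * coeff n (eulerSeries q * PowerSeries.mk φ) := by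
  set F := PowerSeries.mk φ with hF
  set e := eulerSeries q with he
  have he1 : e = (1 - X) * rescale q e := eulerSeries_eq hq0 hq1
  have he2 : rescale q e = (1 - C q * X) * rescale q (rescale q e) := by
    conv_lhs => rw [he1]
    rw [map_mul, map_sub, map_one, rescale_X]
  -- The recurrence for `φ` as an equation: `(1-x)F(x) - (1+b)F(qx) + b(1+qx)F(q²x) = 0`; the case
  -- of the constant term is `1 - (1+b) + b = 0`.
  have hFeq : (1 - X) * F - C (1 + b) * rescale q F +
      C b * ((1 + C q * X) * rescale q (rescale q F)) = 0 := by
    ext m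
    rcases m with _ | m
    · simp [sub_mul, add_mul, mul_assoc, hF, constantCoeff_rescale]
    · simp only [sub_mul, add_mul, one_mul, mul_assoc, map_sub, map_add, coeff_C_mul,
        coeff_succ_X_mul, coeff_rescale, hF, coeff_mk, map_zero]
      linear_combination hφ m
  -- Multiply by `(qx;q)_∞`. The last factor becomes `(1+qx)(1-qx) = 1 - q²x²`, so the equation for
  -- the product involves `x` explicitly only through `x²` and preserves parity.
  have hP : e * F - C (1 + b) * rescale q (e * F) +
      C b * ((1 - C (q ^ 2) * X ^ 2) * rescale q (rescale q (e * F))) = 0 := by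
    simp only [map_mul, map_pow]
    linear_combination F * he1 + rescale q e * hFeq -
      C b * (1 + C q * X) * rescale q (rescale q F) * he2
  have := congrArg (coeff (n + 2)) hP
  rw [map_add, map_sub, coeff_C_mul] at this
  simp only [sub_mul, one_mul, mul_assoc, map_sub, coeff_C_mul, coeff_rescale, map_zero,
    coeff_X_pow_mul] at this
  linear_combination this

end Product

/-! ### The coefficients of the quotient `g(it) / E_q(-t/2)`. -/

/-- The coefficient `(q^{2α+1};q²)_m / ((q^{2α+1};q)_m (q;q)_m)`. -/
noncomputable def expansionCoeff (α q : ℝ) (m : ℕ) : ℝ := pochRatio α q m / qPoch q q m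

section Expansion

variable {α q : ℝ}

theorem sq_rpow_mul_sq (hq0 : 0 < q) : (q ^ 2) ^ α * q ^ 2 = q ^ (2 * α + 2) := by
  rw [Real.rpow_add hq0, Real.rpow_mul hq0.le]
  norm_num

theorem sq_rpow_mul (hq0 : 0 < q) : (q ^ 2) ^ α * q = q ^ (2 * α + 1) := by
  rw [Real.rpow_add hq0, Real.rpow_mul hq0.le]
  norm_num

theorem sq_rpow_mul_sq_lt_one (hq0 : 0 < q) (hq1 : q < 1) (hα : -1 < α) :
    (q ^ 2) ^ α * q ^ 2 < 1 := by
  rw [sq_rpow_mul_sq hq0]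
  exact Real.rpow_lt_one hq0.le hq1 (by linarith)

theorem one_sub_sq_rpow_mul_pow_pos (hq0 : 0 < q) (hq1 : q < 1) (hα : -1 < α) (n : ℕ) :
    0 < 1 - (q ^ 2) ^ α * q ^ (n + 2) := by
  have h := sq_rpow_mul_sq_lt_one hq0 hq1 hα
  have h1 : q ^ n ≤ 1 := pow_le_one₀ hq0.le hq1.le
  have h2 : (q ^ 2) ^ α * q ^ (n + 2) = (q ^ 2) ^ α * q ^ 2 * q ^ n := by ring
  have h3 : 0 < (q ^ 2) ^ α * q ^ 2 := by positivity
  nlinarith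

theorem expansionCoeff_zero : expansionCoeff α q 0 = 1 := by
  simp [expansionCoeff, pochRatio, qPoch]

theorem sq_rpow_mul_ne_one (hq0 : 0 < q) (hq1 : q < 1) (h : α ≠ -1 / 2) :
    1 - (q ^ 2) ^ α * q ≠ 0 := by
  rw [sq_rpow_mul hq0]
  intro h1
  have h2 : q ^ (2 * α + 1) = q ^ (0 : ℝ) := by rw [Real.rpow_zero]; linarith
  have h3 := (Real.rpow_right_inj hq0 hq1.ne).1 h2
  exact h (by linarith)

/-- The recurrence does not determine this value at `α = -1/2`, where both sides at `m = 0` carry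
the factor `1 - q^{2α+1} = 0`. It is what makes the linear coefficient of the product with `(x;q)_∞`
vanish, and with it all odd ones. -/
theorem expansionCoeff_one (hq0 : 0 < q) (hq1 : q < 1) :
    expansionCoeff α q 1 = 1 / (1 - q) := by
  unfold expansionCoeff pochRatio
  split_ifs with h h1
  · exact absurd h1 (by simp)
  · simp [qPoch]
  · have := sq_rpow_mul_ne_one hq0 hq1 h
    rw [sq_rpow_mul hq0] at this
    simp [qPoch, div_self this]

theorem expansionCoeff_succ (hq0 : 0 < q) (hq1 : q < 1) (hα : -1 < α) (m : ℕ) :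
    expansionCoeff α q (m + 1) * ((1 - q ^ (m + 1)) * (1 - (q ^ 2) ^ α * q ^ (m + 1))) =
      (1 - (q ^ 2) ^ α * q ^ (2 * m + 1)) * expansionCoeff α q m := by
  have h3 := (qPoch_pos hq1 hq0 hq1 (m + 1)).ne'
  rw [qPoch_succ] at h3
  have h4 := left_ne_zero_of_mul h3
  have h5 := right_ne_zero_of_mul h3
  have e : q ^ (m + 1) = q * q ^ m := pow_succ' _ _
  by_cases hα' : α = -1 / 2
  · have hb : (q ^ 2) ^ α * q = 1 := by
      rw [sq_rpow_mul hq0, hα']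
      norm_num
    rw [show (q ^ 2) ^ α * q ^ (m + 1) = (q ^ 2) ^ α * q * q ^ m by ring,
      show (q ^ 2) ^ α * q ^ (2 * m + 1) = (q ^ 2) ^ α * q * (q ^ m * q ^ m) by ring, hb]
    rcases m with _ | m
    · simp
    · simp only [expansionCoeff, pochRatio, if_pos hα', Nat.succ_ne_zero, if_false,
        Nat.add_sub_cancel]
      rw [qPoch_succ q q (m + 1), qPoch_succ (-q), e]
      field_simp
      ring
  · have hne : ∀ n, qPoch ((q ^ 2) ^ α * q) q n ≠ 0 := by
      intro n
      refine Finset.prod_ne_zero_iff.2 fun k _ => ?_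
      rcases k with _ | k
      · simpa using sq_rpow_mul_ne_one hq0 hq1 hα'
      · have := (one_sub_sq_rpow_mul_pow_pos hq0 hq1 hα k).ne'
        rwa [show (q ^ 2) ^ α * q * q ^ (k + 1) = (q ^ 2) ^ α * q ^ (k + 2) by ring]
    have h6 := hne (m + 1)
    rw [qPoch_succ] at h6
    have h7 := left_ne_zero_of_mul h6
    have h8 := right_ne_zero_of_mul h6
    simp only [expansionCoeff, pochRatio, if_neg hα', ← sq_rpow_mul hq0]
    rw [qPoch_succ q, qPoch_succ _ q, qPoch_succ _ (q ^ 2), e,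
      show (q ^ 2) ^ α * (q * q ^ m) = (q ^ 2) ^ α * q * q ^ m by ring,
      show (q ^ 2) ^ α * q ^ (2 * m + 1) = (q ^ 2) ^ α * q * (q ^ 2) ^ m by ring]
    generalize (q ^ 2) ^ α * q = A at *
    field_simp

theorem coeff_one_eulerSeries_mul (hq0 : 0 < q) (hq1 : q < 1) :
    coeff 1 (eulerSeries q * PowerSeries.mk (expansionCoeff α q)) = 0 := by
  rw [coeff_mul, Finset.Nat.sum_antidiagonal_succ]
  simp [expansionCoeff_zero, expansionCoeff_one hq0 hq1, eulerSeries, qPoch]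

theorem coeff_odd_eulerSeries_mul (hq0 : 0 < q) (hq1 : q < 1) (hα : -1 < α) (n : ℕ) :
    coeff (2 * n + 1) (eulerSeries q * PowerSeries.mk (expansionCoeff α q)) = 0 := by
  induction n with
  | zero => exact coeff_one_eulerSeries_mul hq0 hq1
  | succ n ih =>
    have := coeff_eulerSeries_mul hq0 hq1 (expansionCoeff_succ hq0 hq1 hα) (2 * n + 1)
    rw [ih, mul_zero] at this
    refine (mul_eq_zero.1 this).resolve_right (mul_ne_zero ?_ ?_)
    · exact (sub_pos.2 (pow_lt_one₀ hq0.le hq1 (by omega))).ne'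
    · exact (one_sub_sq_rpow_mul_pow_pos hq0 hq1 hα _).ne'

theorem coeff_even_eulerSeries_mul (hq0 : 0 < q) (hq1 : q < 1) (hα : -1 < α) (n : ℕ) :
    coeff (2 * n) (eulerSeries q * PowerSeries.mk (expansionCoeff α q)) =
      (-1) ^ n * coeff n (besselSeries (q ^ 2) ((q ^ 2) ^ α)) := by
  induction n with
  | zero => simp [eulerSeries, expansionCoeff_zero, besselSeries, qPoch]
  | succ n ih =>
    have := coeff_eulerSeries_mul hq0 hq1 (expansionCoeff_succ hq0 hq1 hα) (2 * n)
    have h1 : 1 - q ^ (2 * n + 2) ≠ 0 := (sub_pos.2 (pow_lt_one₀ hq0.le hq1 (by omega))).ne'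
    have h2 := (one_sub_sq_rpow_mul_pow_pos hq0 hq1 hα (2 * n)).ne'
    rw [ih] at this
    rw [coeff_succ_besselSeries (by positivity) (pow_lt_one₀ hq0.le hq1 two_ne_zero)
      (sq_rpow_mul_sq_lt_one hq0 hq1 hα)]
    refine mul_right_cancel₀ (mul_ne_zero h1 h2) ?_
    rw [show 2 * (n + 1) = 2 * n + 2 by ring, this,
      show (q ^ 2) ^ (n + 1) = q ^ (2 * n + 2) by ring,
      show (q ^ 2) ^ α * q ^ 2 * (q ^ 2) ^ n = (q ^ 2) ^ α * q ^ (2 * n + 2) by ring]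
    field_simp
    ring

end Expansion

end QBernoulli

/-! ### Convergence, zero-free discs and the generating function. -/

namespace QBernoulli

open PowerSeries

theorem SumsTo.of_recurrence {P : PowerSeries ℝ} {ρ : ℕ → ℝ} {l R : ℝ}
    (hP : ∀ n, coeff (n + 1) P = ρ n * coeff n P) (hρ : Tendsto ρ atTop (𝓝 l))
    (hR : |l| * R ≤ 1) :
    SumsTo (P.map Complex.ofRealHom) (fun t => ∑' n, ((coeff n P : ℝ) : ℂ) * t ^ n) R := by
  intro t ht
  have hlt : ‖(l : ℂ)‖ * ‖t‖ < 1 := by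
    rw [Complex.norm_real, Real.norm_eq_abs]
    rcases (abs_nonneg l).eq_or_lt with h | h
    · rw [← h, zero_mul]
      exact one_pos
    · exact (mul_lt_mul_of_pos_left ht h).trans_le hR
  have := summable_of_recurrence (c := fun n => ((coeff n P : ℝ) : ℂ)) (ρ := fun n => (ρ n : ℂ))
    (l := l) (fun n => by rw [hP]; push_cast; rfl)
    ((Complex.continuous_ofReal.tendsto l).comp hρ) hlt
  simpa using this.hasSum

/-- For entire functions `c = 0` is allowed, which `E_q(zt)` at `z = 0` needs. -/
theorem SumsTo.rescale_of_forall {P : PowerSeries ℂ} {F : ℂ → ℂ} (h : ∀ R, SumsTo P F R)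
    (c : ℂ) (R : ℝ) : SumsTo (PowerSeries.rescale c P) (fun t => F (c * t)) R := by
  intro t _
  refine (h (‖c * t‖ + 1) (c * t) (lt_add_one _)).congr_fun fun n => ?_
  rw [PowerSeries.coeff_rescale, mul_pow]
  ring

section Bessel

variable {p b : ℝ}

theorem sumsTo_besselSeries (hp0 : 0 < p) (hp1 : p < 1) (hb : b * p < 1) (R : ℝ) :
    SumsTo ((besselSeries p b).map Complex.ofRealHom)
      (fun w => ∑' n, ((coeff n (besselSeries p b) : ℝ) : ℂ) * w ^ n) R := by
  refine SumsTo.of_recurrence (coeff_succ_besselSeries hp0 hp1 hb) (l := 0) ?_ (by simp)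
  have h0 : Tendsto (fun n : ℕ => p ^ n) atTop (𝓝 0) :=
    tendsto_pow_atTop_nhds_zero_of_lt_one hp0.le hp1
  have hc : ContinuousAt (fun x : ℝ => -(p * x ^ 2 * b / ((1 - p * x) * (1 - b * p * x)))) 0 := by
    refine ContinuousAt.neg (ContinuousAt.div (by fun_prop) (by fun_prop) ?_)
    simp
  have := hc.tendsto.comp h0
  simp only [Function.comp_def, ne_eq, OfNat.ofNat_ne_zero, not_false_eq_true, zero_pow, mul_zero,
    zero_mul, zero_div, neg_zero] at this
  refine this.congr fun n => ?_
  ring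

theorem modBesselJ2_eq_tsum (α : ℝ) (hp0 : 0 < p) (z : ℂ) :
    modBesselJ2 α p z = ∑' n, ((coeff n (besselSeries p (p ^ α)) : ℝ) : ℂ) * ((z / 2) ^ 2) ^ n := by
  refine tsum_congr fun n => ?_
  have e1 : p ^ ((n : ℝ) * (α + n)) = p ^ (n ^ 2) * (p ^ α) ^ n := by
    rw [mul_add, Real.rpow_add hp0, mul_comm (n : ℝ) α, Real.rpow_mul_natCast hp0.le, mul_comm]
    congr 1
    rw [← Real.rpow_natCast]
    push_cast
    ring_nf
  have e2 : p ^ (α + 1) = p ^ α * p := by rw [Real.rpow_add hp0, Real.rpow_one]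
  simp only [e1, e2, besselSeries, coeff_mk, pow_mul]
  push_cast
  ring

end Bessel

section Q

variable {α q : ℝ}

/-- Below the first positive zero of `J_α^{(2)}` there is no complex zero either. -/
theorem modBesselJ2_ne_zero (hq0 : 0 < q) (hq1 : q < 1) (hα : -1 < α) {j : ℝ}
    (hj : IsFirstZero α q j) {z : ℂ} (hz : ‖z‖ < j) : modBesselJ2 α (q ^ 2) z ≠ 0 := by
  have hp0 : 0 < q ^ 2 := by positivity
  have hp1 : q ^ 2 < 1 := pow_lt_one₀ hq0.le hq1 two_ne_zero
  have hb := sq_rpow_mul_sq_lt_one hq0 hq1 hα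
  have hj0 : 0 < j := hj.1.1
  rw [modBesselJ2_eq_tsum α hp0]
  refine ne_zero_of_coeff_inv_nonneg (W := (j / 2) ^ 2) constantCoeff_besselSeries
    (coeff_inv_besselSeries_nonneg hp0 hp1 (Real.rpow_pos_of_pos hp0 α) hb)
    (sumsTo_besselSeries hp0 hp1 hb) ?_ ?_
  -- The series variable is `z²/4`, so a zero at `x` in `(0, (j/2)²)` would give the zero `2√x < j`
  -- of the Bessel function.
  · intro x hx0 hxW h0
    have hlt : 2 * √x < j := by
      have : √x < j / 2 := (Real.sqrt_lt' (by positivity)).2 hxW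
      linarith
    have hpos : 0 < 2 * √x := by positivity
    have hsq : (((2 * √x : ℝ) : ℂ) / 2) ^ 2 = x := by
      push_cast
      rw [mul_div_cancel_left₀ _ two_ne_zero, ← Complex.ofReal_pow, Real.sq_sqrt hx0.le]
    have hzero : besselJ2 α (q ^ 2) ((2 * √x : ℝ) : ℂ) = 0 := by
      rw [besselJ2_eq α (q ^ 2) (Complex.ofReal_ne_zero.2 hpos.ne'), modBesselJ2_eq_tsum α hp0,
        hsq, h0, mul_zero]
    exact absurd (hj.2 ⟨hpos, hzero⟩) hlt.not_ge
  · rw [norm_pow, norm_div, Complex.norm_two]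
    gcongr

theorem norm_one_sub_ofReal (hq1 : q < 1) : ‖(1 - (q : ℂ))‖ = 1 - q := by
  rw [← Complex.ofReal_one, ← Complex.ofReal_sub, Complex.norm_real,
    Real.norm_of_nonneg (sub_pos.2 hq1).le]

theorem g2_ne_zero (hq0 : 0 < q) (hq1 : q < 1) (hα : -1 < α) {j : ℝ}
    (hj : IsFirstZero α q j) {t : ℂ} (ht : ‖t‖ < j / (1 - q)) :
    g2 α q (Complex.I * t) ≠ 0 := by
  refine modBesselJ2_ne_zero hq0 hq1 hα hj ?_
  rw [norm_mul, norm_mul, Complex.norm_I, one_mul, norm_one_sub_ofReal hq1]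
  exact (lt_div_iff₀ (sub_pos.2 hq1)).1 ht

theorem Psi_eq (hq1 : q < 1) (n : ℕ) :
    Psi q n = q ^ (n * (n - 1) / 2) / qPoch q q n * (1 - q) ^ n := by
  rw [Psi, qFact_eq hq1, div_div_eq_mul_div, mul_div_right_comm]

theorem Psi_pos (hq0 : 0 < q) (hq1 : q < 1) (n : ℕ) : 0 < Psi q n := by
  rw [Psi_eq hq1]
  have := qPoch_pos hq1 hq0 hq1 n
  have := sub_pos.2 hq1
  positivity

theorem bigEq_eq_tsum (hq1 : q < 1) (z : ℂ) : bigEq q z = ∑' n, (Psi q n : ℂ) * z ^ n := by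
  refine tsum_congr fun n => ?_
  rw [Psi_eq hq1, mul_pow]
  push_cast
  ring

theorem sumsTo_bigEq (hq0 : 0 < q) (hq1 : q < 1) (R : ℝ) :
    SumsTo ((PowerSeries.mk (Psi q)).map Complex.ofRealHom) (bigEq q) R := by
  have hrec : ∀ n, coeff (n + 1) (PowerSeries.mk (Psi q)) =
      q ^ n * (1 - q) / (1 - q ^ (n + 1)) * coeff n (PowerSeries.mk (Psi q)) := by
    intro n
    have h3 := (qPoch_pos hq1 hq0 hq1 (n + 1)).ne'
    rw [qPoch_succ] at h3
    have h4 := left_ne_zero_of_mul h3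
    have h5 := right_ne_zero_of_mul h3
    simp only [coeff_mk, Psi_eq hq1, triangle_succ, qPoch_succ]
    rw [pow_succ' q n]
    field_simp
    ring
  have h0 : Tendsto (fun n : ℕ => q ^ n) atTop (𝓝 0) :=
    tendsto_pow_atTop_nhds_zero_of_lt_one hq0.le hq1
  have hc : ContinuousAt (fun x : ℝ => x * (1 - q) / (1 - x * q)) 0 :=
    ContinuousAt.div (by fun_prop) (by fun_prop) (by simp)
  have ht := hc.tendsto.comp h0
  simp only [Function.comp_def, zero_mul, zero_div, ← pow_succ] at ht
  refine (SumsTo.of_recurrence hrec ht (by simp)).congr fun t _ => ?_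
  simp [bigEq_eq_tsum hq1]

/-- The power series of `g_α^{(2)}(it;q) / E_q(-t/2)`. -/
noncomputable def quotientSeries (α q : ℝ) : PowerSeries ℂ :=
  rescale ((1 - (q : ℂ)) / 2) ((PowerSeries.mk (expansionCoeff α q)).map Complex.ofRealHom)

theorem one_sub_ofReal_ne_zero (hq1 : q < 1) : (1 - (q : ℂ)) / 2 ≠ 0 := by
  refine div_ne_zero ?_ two_ne_zero
  rw [← norm_ne_zero_iff, norm_one_sub_ofReal hq1]
  exact (sub_pos.2 hq1).ne'

theorem sumsTo_quotientSeries (hq0 : 0 < q) (hq1 : q < 1) (hα : -1 < α) :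
    ∃ D : ℂ → ℂ, SumsTo (quotientSeries α q) D (2 / (1 - q)) := by
  -- The recurrence is used from index `1` on: its first denominator contains `1 - q^{2α+1}`, which
  -- vanishes at `α = -1/2`. The ratio tends to `1`, hence the radius `1` in `x = (1-q)t/2`.
  have hrec : ∀ n, coeff (n + 1 + 1) (PowerSeries.mk (expansionCoeff α q)) =
      (1 - (q ^ 2) ^ α * q ^ (2 * (n + 1) + 1)) /
        ((1 - q ^ (n + 2)) * (1 - (q ^ 2) ^ α * q ^ (n + 2))) *
        coeff (n + 1) (PowerSeries.mk (expansionCoeff α q)) := by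
    intro n
    have h1 : 1 - q ^ (n + 2) ≠ 0 := (sub_pos.2 (pow_lt_one₀ hq0.le hq1 (by omega))).ne'
    have h2 := (one_sub_sq_rpow_mul_pow_pos hq0 hq1 hα n).ne'
    rw [coeff_mk, coeff_mk, div_mul_eq_mul_div, eq_div_iff (mul_ne_zero h1 h2)]
    exact expansionCoeff_succ hq0 hq1 hα (n + 1)
  have h0 : Tendsto (fun n : ℕ => q ^ n) atTop (𝓝 0) :=
    tendsto_pow_atTop_nhds_zero_of_lt_one hq0.le hq1
  have hc : ContinuousAt (fun x : ℝ => (1 - (q ^ 2) ^ α * (x ^ 2 * q ^ 3)) /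
      ((1 - x * q ^ 2) * (1 - (q ^ 2) ^ α * (x * q ^ 2)))) 0 :=
    ContinuousAt.div (by fun_prop) (by fun_prop) (by simp)
  have ht := hc.tendsto.comp h0
  simp only [Function.comp_def, zero_mul, mul_zero, sub_zero, ne_eq, OfNat.ofNat_ne_zero,
    not_false_eq_true, zero_pow, mul_one, div_one] at ht
  have hsum : ∀ t : ℂ, ‖t‖ < 1 →
      Summable fun n => (expansionCoeff α q n : ℂ) * t ^ n := by
    intro t ht1
    have := summable_of_recurrence (c := fun n => (expansionCoeff α q (n + 1) : ℂ))
      (ρ := fun n => (((1 - (q ^ 2) ^ α * q ^ (2 * (n + 1) + 1)) /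
        ((1 - q ^ (n + 2)) * (1 - (q ^ 2) ^ α * q ^ (n + 2))) : ℝ) : ℂ))
      (l := ((1 : ℝ) : ℂ)) (t := t) (fun n => ?_)
      ((Complex.continuous_ofReal.tendsto 1).comp (ht.congr fun n => ?_)) (by simpa using ht1)
    · rw [← summable_nat_add_iff 1]
      refine (this.mul_right t).congr fun n => ?_
      ring
    · have := hrec n
      rw [coeff_mk, coeff_mk] at this
      rw [this]
      push_cast
      rfl
    · ring
  have hs : SumsTo ((PowerSeries.mk (expansionCoeff α q)).map Complex.ofRealHom)
      (fun t => ∑' n, (expansionCoeff α q n : ℂ) * t ^ n) 1 := by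
    intro t ht1
    simpa using (hsum t ht1).hasSum
  refine ⟨_, hs.rescale ((1 - (q : ℂ)) / 2) (le_of_eq ?_) (one_sub_ofReal_ne_zero hq1)⟩
  have := (sub_pos.2 hq1).ne'
  rw [norm_div, norm_one_sub_ofReal hq1, Complex.norm_two]
  field_simp

theorem rescale_neg_half_Psi (hq1 : q < 1) :
    rescale (-1 / 2 : ℂ) ((PowerSeries.mk (Psi q)).map Complex.ofRealHom) =
      rescale ((1 - (q : ℂ)) / 2) ((eulerSeries q).map Complex.ofRealHom) := by
  ext n
  simp only [coeff_rescale, coeff_map, coeff_mk, eulerSeries, Psi_eq hq1,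
    Complex.ofRealHom_eq_coe]
  push_cast
  rw [div_pow, div_pow]
  ring

/-- With `x = (1-q)t/2`, the product of `(x;q)_∞` and the quotient series is even in `x`. Its even
part is the Bessel series at `-x²`, and `-x² = (it(1-q)/2)²` is the argument in `g(it)`. -/
theorem bigEq_mul_quotient (hq0 : 0 < q) (hq1 : q < 1) (hα : -1 < α) {D : ℂ → ℂ}
    (hD : SumsTo (quotientSeries α q) D (2 / (1 - q))) {t : ℂ} (ht : ‖t‖ < 2 / (1 - q)) :
    bigEq q (-t / 2) * D t = g2 α q (Complex.I * t) := by
  have h1 := SumsTo.rescale_of_forall (sumsTo_bigEq hq0 hq1) (-1 / 2) (2 / (1 - q))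
  rw [rescale_neg_half_Psi hq1] at h1
  have h2 := h1.mul hD t ht
  rw [quotientSeries, ← map_mul, ← map_mul] at h2
  change HasSum _ (bigEq q (-1 / 2 * t) * D t) at h2
  rw [show -1 / 2 * t = -t / 2 by ring] at h2
  rw [← h2.tsum_eq, g2, modBesselJ2_eq_tsum α (by positivity)]
  refine HasSum.tsum_eq ?_
  rw [← (mul_right_injective₀ (two_ne_zero (α := ℕ))).hasSum_iff]
  · have hb := sumsTo_besselSeries (p := q ^ 2) (b := (q ^ 2) ^ α) (by positivity)
      (pow_lt_one₀ hq0.le hq1 two_ne_zero) (sq_rpow_mul_sq_lt_one hq0 hq1 hα)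
      (‖(Complex.I * t * (1 - (q : ℂ)) / 2) ^ 2‖ + 1) _ (lt_add_one _)
    refine hb.congr_fun fun n => ?_
    simp only [Function.comp_apply, coeff_rescale, coeff_map, Complex.ofRealHom_eq_coe,
      coeff_even_eulerSeries_mul hq0 hq1 hα]
    have hI : (Complex.I * t * (1 - (q : ℂ)) / 2) ^ 2 =
        (-1) * ((1 - (q : ℂ)) / 2 * t) ^ 2 := by
      rw [← Complex.I_sq]
      ring
    rw [hI, mul_pow (-1 : ℂ), ← pow_mul, mul_pow (_ / _) t (2 * n)]
    push_cast
    ring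
  · intro n hn
    obtain ⟨k, rfl⟩ : Odd n := by
      rw [← Nat.not_even_iff_odd]
      rintro ⟨m, rfl⟩
      exact hn ⟨m, by simp [two_mul]⟩
    simp only [coeff_rescale, coeff_map, coeff_odd_eulerSeries_mul hq0 hq1 hα, map_zero, mul_zero,
      zero_mul]

theorem sumsTo_genFun (hq0 : 0 < q) (hq1 : q < 1) (hα : -1 < α) {j : ℝ}
    (hj : IsFirstZero α q j) (z : ℂ) :
    SumsTo (PowerSeries.mk fun n => iteratedDeriv n (genFun α q z) 0 / (n.factorial : ℂ))
      (genFun α q z) (j / (1 - q)) := by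
  have hE : Differentiable ℂ (bigEq q) := fun w =>
    ((sumsTo_bigEq hq0 hq1 (‖w‖ + 1)).differentiableOn (by positivity)).differentiableAt
      (Metric.isOpen_ball.mem_nhds (by simp))
  have hg : Differentiable ℂ (g2 α q) := by
    have hB : Differentiable ℂ fun w : ℂ =>
        ∑' n, ((coeff n (besselSeries (q ^ 2) ((q ^ 2) ^ α)) : ℝ) : ℂ) * w ^ n := fun w =>
      ((sumsTo_besselSeries (p := q ^ 2) (b := (q ^ 2) ^ α) (by positivity)
        (pow_lt_one₀ hq0.le hq1 two_ne_zero) (sq_rpow_mul_sq_lt_one hq0 hq1 hα)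
        (‖w‖ + 1)).differentiableOn (by positivity)).differentiableAt
        (Metric.isOpen_ball.mem_nhds (by simp))
    have he : g2 α q = fun t => (fun w : ℂ =>
        ∑' n, ((coeff n (besselSeries (q ^ 2) ((q ^ 2) ^ α)) : ℝ) : ℂ) * w ^ n)
        ((t * (1 - (q : ℂ)) / 2) ^ 2) :=
      funext fun t => modBesselJ2_eq_tsum α (by positivity) _
    rw [he]
    exact hB.comp (by fun_prop)
  refine SumsTo.taylor (DifferentiableOn.div (Differentiable.differentiableOn ?_)
    (Differentiable.differentiableOn ?_) fun t ht => g2_ne_zero hq0 hq1 hα hj (by simpa using ht))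
  · exact (hE.comp (by fun_prop)).mul (hE.comp (by fun_prop))
  · exact hg.comp (by fun_prop)

/-- The expansion of `Ψ_k z^k` in the generalized `q`-Bernoulli polynomials. -/
theorem sum_antidiagonal_iteratedDeriv_genFun (hq0 : 0 < q) (hq1 : q < 1) (hα : -1 < α) {j : ℝ}
    (hj : IsFirstZero α q j) (z : ℂ) (k : ℕ) :
    ∑ x ∈ Finset.HasAntidiagonal.antidiagonal k,
      iteratedDeriv x.1 (genFun α q z) 0 / (x.1.factorial : ℂ) * coeff x.2 (quotientSeries α q) =
      Psi q k * z ^ k := by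
  obtain ⟨D, hD⟩ := sumsTo_quotientSeries hq0 hq1 hα
  have h1q := sub_pos.2 hq1
  have hR : 0 < min (2 / (1 - q)) (j / (1 - q)) :=
    lt_min (div_pos two_pos h1q) (div_pos hj.1.1 h1q)
  have h1 := ((sumsTo_genFun hq0 hq1 hα hj z).mono (min_le_right (2 / (1 - q)) _)).mul
    (hD.mono (min_le_left _ (j / (1 - q))))
  have h2 := SumsTo.rescale_of_forall (sumsTo_bigEq hq0 hq1) z
    (min (2 / (1 - q)) (j / (1 - q)))
  have h3 := h1.congr (G := fun t => bigEq q (z * t)) fun t ht => by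
    have hne := g2_ne_zero hq0 hq1 hα hj (ht.trans_le (min_le_right _ _))
    rw [genFun, div_mul_eq_mul_div, mul_assoc,
      bigEq_mul_quotient hq0 hq1 hα hD (ht.trans_le (min_le_left _ _)), mul_div_cancel_right₀ _ hne]
  have h4 := congrArg (coeff k) (h3.unique h2 hR)
  simp only [coeff_mul, coeff_rescale, coeff_map, coeff_mk, Complex.ofRealHom_eq_coe] at h4
  rw [h4, mul_comm]

end Q

/-! ### Geometric bounds and rearrangement of the double series. -/

theorem exists_norm_le_of_limsup_lt {x : ℕ → ℂ} {τ ρ : ℝ} (hρ : 0 < ρ) (hτρ : τ < ρ)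
    (hlim : limsup (fun n : ℕ => ENNReal.ofReal (‖x n‖ ^ (1 / (n : ℝ)))) atTop =
      ENNReal.ofReal τ) : ∃ C, ∀ n, ‖x n‖ ≤ C * ρ ^ n := by
  have h1 := eventually_lt_of_limsup_lt
    (hlim.trans_lt ((ENNReal.ofReal_lt_ofReal_iff hρ).2 hτρ))
  have h2 : x =O[atTop] fun n : ℕ => ρ ^ n := by
    refine Asymptotics.IsBigO.of_bound 1 ?_
    filter_upwards [h1, eventually_ne_atTop 0] with n hn hn0
    rw [ENNReal.ofReal_lt_ofReal_iff hρ, one_div] at hn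
    rw [one_mul, Real.norm_of_nonneg (by positivity), ← Real.rpow_inv_natCast_pow
      (norm_nonneg (x n)) hn0]
    exact pow_le_pow_left₀ (by positivity) hn.le n
  -- The eventual bound extends to all `n`, since `ρ ^ n` never vanishes and only finitely many
  -- terms are left.
  obtain ⟨C, -, hb⟩ := Asymptotics.bound_of_isBigO_nat_atTop h2
  refine ⟨C, fun n => ?_⟩
  have := hb (x := n) (by positivity)
  rwa [Real.norm_of_nonneg (by positivity)] at this

/-- The shift `m ↦ n + m` as an equivalence onto `{k | n ≤ k}`. -/
def natEquivIci (n : ℕ) : ℕ ≃ Set.Ici n where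
  toFun m := ⟨n + m, Nat.le_add_right n m⟩
  invFun k := k - n
  left_inv m := Nat.add_sub_cancel_left n m
  right_inv k := Subtype.ext (Nat.add_sub_cancel' k.2)

/-- Rearrangement of a double series: if `∑_{n+m=k} b_n d_m = e_k`, then
`∑_k x_k e_k = ∑_n (∑_m x_{n+m} d_m) b_n`. -/
theorem hasSum_rearrange {x d b e : ℕ → ℂ} {ρ C : ℝ} (hρ : 0 ≤ ρ)
    (hx : ∀ n, ‖x n‖ ≤ C * ρ ^ n) (hd : Summable fun m => ‖d m‖ * ρ ^ m)
    (hb : Summable fun n => ‖b n‖ * ρ ^ n)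
    (he : ∀ k, ∑ y ∈ Finset.HasAntidiagonal.antidiagonal k, b y.1 * d y.2 = e k) {s : ℂ}
    (hs : HasSum (fun k => x k * e k) s) :
    (∀ n, Summable fun m => x (n + m) * d m) ∧
      HasSum (fun n => (∑' m, x (n + m) * d m) * b n) s := by
  have h1 : ∀ n, Summable fun m => x (n + m) * d m := by
    intro n
    refine Summable.of_norm_bounded (hd.mul_left (C * ρ ^ n)) fun m => ?_
    rw [norm_mul]
    calc ‖x (n + m)‖ * ‖d m‖ ≤ C * ρ ^ (n + m) * ‖d m‖ := by gcongr; exact hx _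
      _ = C * ρ ^ n * (‖d m‖ * ρ ^ m) := by ring
  refine ⟨h1, ?_⟩
  -- Since `ρ^{n+m} = ρ^n ρ^m`, the double family is dominated by a product of two convergent
  -- series. It may then be summed along rows or along antidiagonals.
  have hT : Summable fun y : ℕ × ℕ => x (y.1 + y.2) * d y.2 * b y.1 := by
    have hbd : Summable fun y : ℕ × ℕ => (‖b y.1‖ * ρ ^ y.1) * (‖d y.2‖ * ρ ^ y.2) :=
      hb.mul_of_nonneg hd (fun n => by positivity) fun m => by positivity
    refine Summable.of_norm_bounded (hbd.mul_left C) fun y => ?_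
    rw [norm_mul, norm_mul]
    calc ‖x (y.1 + y.2)‖ * ‖d y.2‖ * ‖b y.1‖ ≤ C * ρ ^ (y.1 + y.2) * ‖d y.2‖ * ‖b y.1‖ := by
          gcongr; exact hx _
      _ = C * ((‖b y.1‖ * ρ ^ y.1) * (‖d y.2‖ * ρ ^ y.2)) := by ring
  have hfib := hT.hasSum.prod_fiberwise fun n => (h1 n).hasSum.mul_right (b n)
  have hanti := (Finset.HasAntidiagonal.sigmaAntidiagonalEquivProd (A := ℕ)).hasSum_iff.2 hT.hasSum
  have hanti2 := hanti.sigma fun k => hasSum_fintype _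
  have hval : ∑' y : ℕ × ℕ, x (y.1 + y.2) * d y.2 * b y.1 = s := by
    refine hanti2.unique (hs.congr_fun fun k => ?_)
    rw [← he, Finset.mul_sum]
    change ∑ y : Finset.HasAntidiagonal.antidiagonal k,
      x ((y : ℕ × ℕ).1 + (y : ℕ × ℕ).2) * d (y : ℕ × ℕ).2 * b (y : ℕ × ℕ).1 = _
    rw [Finset.sum_coe_sort (Finset.HasAntidiagonal.antidiagonal k)
      (fun y : ℕ × ℕ => x (y.1 + y.2) * d y.2 * b y.1)]
    refine Finset.sum_congr rfl fun y hy => ?_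
    rw [Finset.HasAntidiagonal.mem_antidiagonal.1 hy]
    ring
  rwa [hval] at hfib

theorem coeffTerm_add {α q : ℝ} (hq0 : 0 < q) (hq1 : q < 1) (a : ℕ → ℂ) (n m : ℕ) :
    coeffTerm α q a n (n + m) =
      (1 - (q : ℂ)) ^ n *
        (a (n + m) / (Psi q (n + m) : ℂ) * coeff m (quotientSeries α q)) := by
  have h1 : (qPoch q q (n + m) : ℂ) ≠ 0 :=
    Complex.ofReal_ne_zero.2 (qPoch_pos hq1 hq0 hq1 _).ne'
  have h2 : (1 - (q : ℂ)) ≠ 0 := by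
    rw [← norm_ne_zero_iff, norm_one_sub_ofReal hq1]
    exact (sub_pos.2 hq1).ne'
  have h3 : (q : ℂ) ^ ((n + m) * (n + m - 1) / 2) ≠ 0 :=
    pow_ne_zero _ (Complex.ofReal_ne_zero.2 hq0.ne')
  rw [coeffTerm, Nat.add_sub_cancel_left, Psi_eq hq1, quotientSeries, coeff_rescale, coeff_map,
    coeff_mk, expansionCoeff, Complex.ofRealHom_eq_coe]
  push_cast
  have h4 : (qPoch q q m : ℂ) ≠ 0 :=
    Complex.ofReal_ne_zero.2 (qPoch_pos hq1 hq0 hq1 _).ne'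
  rw [div_pow, div_pow, one_pow, pow_add (1 - (q : ℂ))]
  field_simp

end QBernoulli

/-! ### The expansion theorem. -/

open QBernoulli

theorem theorem4p5 (q α : ℝ) (hq0 : 0 < q) (hq1 : q < 1) (hα : -1 < α)
    (j : ℝ) (hj : QBernoulli.IsFirstZero α q j)
    (f : ℂ → ℂ) (a : ℕ → ℂ) (hf : ∀ z : ℂ, HasSum (fun n : ℕ => a n * z ^ n) (f z))
    (τ : ℝ) (hτ0 : 0 ≤ τ) (hτ : τ < min (2 / (1 - q)) (j / (1 - q)))
    (hlim : Filter.limsup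
        (fun n : ℕ => ENNReal.ofReal (‖a n / (QBernoulli.Psi q n : ℂ)‖ ^ (1 / (n : ℝ))))
        Filter.atTop = ENNReal.ofReal τ) :
    (∀ n : ℕ, Summable (fun k : Set.Ici n => QBernoulli.coeffTerm α q a n k)) ∧
    ∀ z : ℂ, HasSum
      (fun n : ℕ => QBernoulli.coeffL α q a n *
        (QBernoulli.bernoulliB2 α q n z / (QBernoulli.qFact q n : ℂ)))
      (f z) := by
  have h1q := sub_pos.2 hq1
  -- The bound `2/(1-q)` on `ρ` serves the quotient series, the bound `j/(1-q)` the generating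
  -- function.
  obtain ⟨ρ, hτρ, hρ⟩ := exists_between hτ
  have hρ0 : 0 < ρ := hτ0.trans_lt hτρ
  obtain ⟨C, hx⟩ := exists_norm_le_of_limsup_lt hρ0 hτρ hlim
  obtain ⟨D, hD⟩ := sumsTo_quotientSeries hq0 hq1 hα
  have hnρ : ‖(ρ : ℂ)‖ = ρ := by rw [Complex.norm_real, Real.norm_of_nonneg hρ0.le]
  have hd : Summable fun m => ‖PowerSeries.coeff m (quotientSeries α q)‖ * ρ ^ m := by
    have := hD.summable_norm (t := ρ) (hnρ.trans_lt (hρ.trans_le (min_le_left _ _)))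
    simpa only [norm_mul, norm_pow, hnρ] using this
  have key := fun z : ℂ => by
    have hb := (sumsTo_genFun hq0 hq1 hα hj z).summable_norm (t := ρ)
      (hnρ.trans_lt (hρ.trans_le (min_le_right _ _)))
    simp only [norm_mul, norm_pow, hnρ, PowerSeries.coeff_mk] at hb
    refine hasSum_rearrange (s := f z) hρ0.le hx hd hb
      (sum_antidiagonal_iteratedDeriv_genFun hq0 hq1 hα hj z) ((hf z).congr_fun fun k => ?_)
    have : (Psi q k : ℂ) ≠ 0 := Complex.ofReal_ne_zero.2 (Psi_pos hq0 hq1 k).ne'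
    field_simp
  constructor
  · intro n
    rw [← (natEquivIci n).summable_iff]
    -- The inner series does not involve `z`, so any value of `z` will do here.
    exact (((key 0).1 n).mul_left ((1 - (q : ℂ)) ^ n)).congr fun m =>
      (coeffTerm_add hq0 hq1 a n m).symm
  · intro z
    refine (key z).2.congr_fun fun n => ?_
    have hfact : (qFact q n : ℂ) ≠ 0 := by
      rw [qFact_eq hq1]
      exact Complex.ofReal_ne_zero.2
        (div_pos (qPoch_pos hq1 hq0 hq1 n) (pow_pos h1q n)).ne'
    have hpow : (1 - (q : ℂ)) ^ n ≠ 0 := by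
      rw [← norm_ne_zero_iff, norm_pow, norm_one_sub_ofReal hq1]
      exact (pow_pos h1q n).ne'
    rw [coeffL, bernoulliB2, mul_div_cancel_left₀ _ hfact, ← (natEquivIci n).tsum_eq,
      ← tsum_mul_left]
    refine congrArg (· * _) (tsum_congr fun m => ?_)
    change _ * coeffTerm α q a n (n + m) = _
    rw [coeffTerm_add hq0 hq1, ← mul_assoc]
    push_cast
    rw [inv_mul_cancel₀ hpow, one_mul]
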